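/- Let $\mathbb K$ be an algebraically closed field of characteristic zero and let $X$ be an irreducible affine variety over $\mathbb K$ that is rigid, i.e. every regular action of the additive group $\mathbb G_a=(\mathbb K,+)$ on $X$ is trivial. Let $\mathrm{Aut}(X)$ be the group of all algebraic automorphisms of $X$; a subgroup $T\subseteq \mathrm{Aut}(X)$ is called a subtorus if it admits the structure of an algebraic torus, i.e. of an algebraic group isomorphic to $(\mathbb K^\times)^r$ for some $r\ge 0$, such that the action $T\times X\to X$ is a morphism of algebraic varieties. Then there is a subtorus $\mathbb T$ in $\mathrm{Aut}(X)$ that contains every other subtorus of $\mathrm{Aut}(X)$. In particular, $\mathbb T$ is the unique maximal subtorus of $\mathrm{Aut}(X)$, and $\mathbb T$ is a normal subgroup of $\mathrm{Aut}(X)$. -/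

import Mathlib

namespace ClassicalVariety

open MvPolynomial

variable {K : Type*} [Field K]

/-- Zariski closed subsets of the affine space `σ → K`. -/
def IsZariskiClosed {σ : Type*} (X : Set (σ → K)) : Prop :=
  ∃ I : Ideal (MvPolynomial σ K), X = zeroLocus K I

/-- Irreducible affine varieties, as irreducible (in particular non-empty) Zariski closed subsets
of the affine space `σ → K`. -/
structure IsIrreducibleAffineVariety {σ : Type*} (X : Set (σ → K)) : Prop where
  isClosed : IsZariskiClosed X
  nonempty : X.Nonempty
  irreducible : ∀ Y Z : Set (σ → K), IsZariskiClosed Y → IsZariskiClosed Z →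
    X ⊆ Y ∪ Z → X ⊆ Y ∨ X ⊆ Z

/-- Let `c : S → (σ → K)` be the coordinate map that identifies `S` with a Zariski closed subset
of affine space. A function on `S` is regular if it is a polynomial in the coordinates. -/
def IsRegularFun {S σ : Type*} (c : S → σ → K) (f : S → K) : Prop :=
  ∃ p : MvPolynomial σ K, ∀ s, f s = eval (c s) p

/-- Morphisms `X → Y` of closed subsets of affine spaces: the coordinates of the image point are
regular functions. -/
def IsMorphism {σ τ : Type*} {X : Set (σ → K)} {Y : Set (τ → K)} (f : X → Y) : Prop :=
  ∀ j, IsRegularFun (fun x : X => x.1) (fun x => (f x).1 j)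

theorem IsMorphism.id {σ : Type*} {X : Set (σ → K)} : IsMorphism (fun x : X => x) :=
  fun j => ⟨MvPolynomial.X j, fun x => by simp⟩

theorem IsMorphism.comp {σ τ υ : Type*} {X : Set (σ → K)} {Y : Set (τ → K)} {Z : Set (υ → K)}
    {g : Y → Z} {f : X → Y} (hg : IsMorphism g) (hf : IsMorphism f) :
    IsMorphism (fun x => g (f x)) := by
  intro j
  obtain ⟨p, hp⟩ := hg j
  choose q hq using hf
  refine ⟨bind₁ q p, fun x => ?_⟩
  have h : (f x).1 = fun i => eval x.1 (q i) := funext fun i => hq i x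
  have e : eval x.1 (bind₁ q p) = eval (fun i => eval x.1 (q i)) p :=
    eval₂Hom_bind₁ (RingHom.id K) x.1 q p
  rw [e, ← h]
  exact hp (f x)

/-- The group `Aut(X)` of algebraic automorphisms of `X`: the bijections `X → X` that are
morphisms together with their inverses. -/
def AutGroup {σ : Type*} (X : Set (σ → K)) : Subgroup (Equiv.Perm X) where
  carrier := {f | IsMorphism (fun x => f x) ∧ IsMorphism (fun x => f⁻¹ x)}
  one_mem' := ⟨IsMorphism.id, IsMorphism.id⟩
  mul_mem' {f g} hf hg := ⟨IsMorphism.comp (g := f) (f := g) hf.1 hg.1, by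
    rw [mul_inv_rev]; exact IsMorphism.comp (g := ⇑g⁻¹) (f := ⇑f⁻¹) hg.2 hf.2⟩
  inv_mem' {f} hf := ⟨hf.2, by rw [inv_inv]; exact hf.1⟩

/-- The action of `G` on `X` given by `φ` is regular, where `G` carries the structure of an affine
variety given by the coordinate map `c`: the map `G × X → X` is a morphism. -/
def IsRegularAction {G ρ σ : Type*} [Group G] (c : G → ρ → K) {X : Set (σ → K)}
    (φ : G →* AutGroup X) : Prop :=
  ∀ j, IsRegularFun (fun p : G × X => Sum.elim (c p.1) p.2.1)
    (fun p => ((φ p.1).1 p.2).1 j)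

/-- The variety structure of the additive group `(K, +)`: the affine line. -/
def gaCoord (s : Multiplicative K) : Unit → K := fun _ => s.toAdd

/-- The variety structure of the torus `(Kˣ)ʳ`: the closed subset `tᵢ uᵢ = 1` of `K²ʳ`. -/
def torusCoord {r : ℕ} (t : Fin r → Kˣ) : Fin r ⊕ Fin r → K :=
  Sum.elim (fun i => (t i : K)) (fun i => ((t i)⁻¹ : Kˣ))

/-- A variety is rigid if every regular action of the additive group on it is trivial. -/
def IsRigid {σ : Type*} (X : Set (σ → K)) : Prop :=
  ∀ φ : Multiplicative K →* AutGroup X, IsRegularAction gaCoord φ → ∀ s, φ s = 1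

/-- A subgroup `T` of `Aut(X)` is a subtorus if it has the structure of an algebraic torus (given
by an isomorphism with some `(Kˣ)ʳ`, `r ≥ 0`) for which the action `T × X → X` is a morphism. -/
def IsSubtorus {σ : Type*} {X : Set (σ → K)} (T : Subgroup (AutGroup X)) : Prop :=
  ∃ (r : ℕ) (φ : (Fin r → Kˣ) ≃* T), IsRegularAction torusCoord (T.subtype.comp φ.toMonoidHom)

end ClassicalVariety

/-! Work in the algebra $A$ of regular functions on $X$. Each $\mathbb G_m$-factor of a torus acting
on $X$ gives a grading of $A$, hence a derivation that is diagonalizable with integral eigenvalues.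
Exponentials turn locally nilpotent derivations into $\mathbb G_a$-actions, so rigidity says that
$A$ has no nonzero ones.

The crux is that any two such diagonalizable derivations $D$, $E$ commute. Split $E$ into
homogeneous components for the $D$-grading. If its highest component had positive degree $k$, the
component of degree $m+qk$ of $E^q f$, for $f$ of weight $m$, would be the $q$-th iterate of that
component on $f$; as the elements $E^q f$ span a finite-dimensional space, their degrees are
bounded, so the component would be locally nilpotent, hence zero. The same argument for $-D$
excludes negative degrees, so $E$ preserves the weight spaces of $D$
(`IsIntegralSemisimple.apply_comm`).

Take the set $S$ of all these derivations. Since the derivations form a Noetherian $A$-module and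
$A$ is a domain, $S$ is simultaneously diagonalizable, and the weights generate a lattice $\mathbb
Z^r$ (`exists_lattice_grading`). The torus $(\mathbb K^\times)^r$ of this grading acts faithfully
and contains every one-parameter factor of every subtorus, since the generator of the factor lies in
$S$. Conjugates of subtori are subtori, which gives normality. -/

/-! ### Maps and gradings built from homogeneous components -/

section GradedAlgebraConstructions

variable {K A ι : Type*} [Field K] [CommRing A] [Algebra K A] [DecidableEq ι]

/-- Linear maps out of a graded space may be prescribed on the homogeneous components. -/
theorem DirectSum.Decomposition.exists_linearMap {M : Type*} [AddCommGroup M] [Module K M]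
    {N : Type*} [AddCommGroup N] [Module K N]
    (𝒜 : ι → Submodule K M) [DirectSum.Decomposition 𝒜] (L : ∀ i, 𝒜 i →ₗ[K] N) :
    ∃ T : M →ₗ[K] N, ∀ i (f : 𝒜 i), T f = L i f := by
  refine ⟨(DirectSum.toModule K ι N L).comp (DirectSum.decomposeLinearEquiv 𝒜).toLinearMap,
    fun i f => ?_⟩
  simp

/-- Derivations of a graded algebra may be prescribed on the homogeneous components. -/
theorem GradedAlgebra.exists_derivation [AddMonoid ι] (𝒜 : ι → Submodule K A) [GradedAlgebra 𝒜]
    (L : ∀ i, 𝒜 i →ₗ[K] A)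
    (hL : ∀ i j (f : 𝒜 i) (g : 𝒜 j),
      L (i + j) ⟨f * g, SetLike.mul_mem_graded f.2 g.2⟩ = (f : A) * L j g + (g : A) * L i f) :
    ∃ D : Derivation K A A, ∀ i (f : 𝒜 i), D f = L i f := by
  obtain ⟨T, hT⟩ := DirectSum.Decomposition.exists_linearMap 𝒜 L
  refine ⟨Derivation.mk' T fun a b => ?_, hT⟩
  simp only [smul_eq_mul]
  induction a using DirectSum.Decomposition.inductionOn 𝒜 with
  | zero => simp
  | add m m' h h' => rw [add_mul, map_add, h, h', map_add]; ring
  | @homogeneous i f =>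
    induction b using DirectSum.Decomposition.inductionOn 𝒜 with
    | zero => simp
    | add m m' h h' => rw [mul_add, map_add, h, h', map_add]; ring
    | @homogeneous j g =>
      rw [hT, hT, ← hL, ← hT]

/-- Endomorphisms of a graded algebra that scale the homogeneous components by the values of a
character. -/
theorem GradedAlgebra.exists_algHom_of_character [AddMonoid ι] (𝒜 : ι → Submodule K A)
    [GradedAlgebra 𝒜] (χ : Multiplicative ι →* K) :
    ∃ T : A →ₐ[K] A, ∀ i, ∀ f ∈ 𝒜 i, T f = χ (Multiplicative.ofAdd i) • f := by
  obtain ⟨T, hT⟩ := DirectSum.Decomposition.exists_linearMap 𝒜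
    (fun i => χ (Multiplicative.ofAdd i) • (𝒜 i).subtype)
  have hT' : ∀ i, ∀ f ∈ 𝒜 i, T f = χ (Multiplicative.ofAdd i) • f := fun i f hf => hT i ⟨f, hf⟩
  refine ⟨AlgHom.ofLinearMap T ?_ ?_, hT'⟩
  · rw [hT' 0 1 SetLike.GradedOne.one_mem]; simp
  · intro a b
    induction a using DirectSum.Decomposition.inductionOn 𝒜 with
    | zero => simp
    | add m m' h h' => rw [add_mul, map_add, h, h', map_add, add_mul]
    | @homogeneous i f =>
      induction b using DirectSum.Decomposition.inductionOn 𝒜 with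
      | zero => simp
      | add m m' h h' => rw [mul_add, map_add, h, h', map_add, mul_add]
      | @homogeneous j g =>
        rw [hT' _ _ f.2, hT' _ _ g.2, hT' _ _ (SetLike.mul_mem_graded f.2 g.2), ofAdd_add, map_mul,
          smul_mul_smul_comm]

/-- The grading of an algebra given by an independent, spanning, multiplicative family. -/
noncomputable abbrev GradedAlgebra.ofIndep [AddMonoid ι] (𝒜 : ι → Submodule K A)
    [SetLike.GradedMonoid 𝒜] (h₁ : iSupIndep 𝒜) (h₂ : iSup 𝒜 = ⊤) : GradedAlgebra 𝒜 :=
  { DirectSum.IsInternal.chooseDecomposition 𝒜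
      ((DirectSum.isInternal_submodule_iff_iSupIndep_and_iSup_eq_top 𝒜).2 ⟨h₁, h₂⟩) with
    toGradedMonoid := inferInstance }

end GradedAlgebraConstructions

/-! ### Weight spaces of a diagonalizable derivation -/

namespace Derivation

open Module

variable {K A : Type*} [Field K] [CommRing A] [Algebra K A]

/-- Locally nilpotent derivations. -/
def IsLocallyNilpotent (D : Derivation K A A) : Prop :=
  ∀ f, ∃ n : ℕ, (⇑D)^[n] f = 0

/-- The weight space of integral weight `m`. -/
def weightSpace (D : Derivation K A A) (m : ℤ) : Submodule K A :=
  End.eigenspace (D : A →ₗ[K] A) (m : K)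

/-- Diagonalizable derivations with integral eigenvalues. -/
def IsIntegralSemisimple (D : Derivation K A A) : Prop :=
  ⨆ m, D.weightSpace m = ⊤

variable {D E : Derivation K A A}

theorem mem_weightSpace {m : ℤ} {f : A} : f ∈ D.weightSpace m ↔ D f = (m : K) • f :=
  End.mem_eigenspace_iff

instance : SetLike.GradedMonoid D.weightSpace where
  one_mem := by simp [mem_weightSpace]
  mul_mem {i j f g} hf hg := by
    rw [mem_weightSpace] at *
    rw [D.leibniz, hf, hg]
    simp only [smul_eq_mul, Algebra.mul_smul_comm, Int.cast_add, add_smul, mul_comm g f]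
    rw [add_comm]

theorem iSupIndep_weightSpace [CharZero K] : iSupIndep D.weightSpace :=
  (End.eigenspaces_iSupIndep (D : A →ₗ[K] A)).comp Int.cast_injective

theorem weightSpace_neg (m : ℤ) : (-D).weightSpace m = D.weightSpace (-m) := by
  ext f
  simp [mem_weightSpace, neg_eq_iff_eq_neg]

theorem IsIntegralSemisimple.neg (hD : D.IsIntegralSemisimple) : (-D).IsIntegralSemisimple := by
  unfold IsIntegralSemisimple at *
  simp_rw [weightSpace_neg]
  rw [← hD]
  exact (Equiv.neg ℤ).iSup_comp (g := D.weightSpace)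

end Derivation

/-! ### Homogeneous components of derivations and commutation -/

section HomogeneousComponents

variable {K A : Type*} [Field K] [CommRing A] [Algebra K A]

theorem Derivation.iterate_eq_zero_of_le {D : Derivation K A A} {f : A} {m n : ℕ}
    (hf : (⇑D)^[m] f = 0) (h : m ≤ n) : (⇑D)^[n] f = 0 := by
  obtain ⟨k, rfl⟩ := Nat.exists_eq_add_of_le' h
  rw [Function.iterate_add_apply, hf, iterate_map_zero]

namespace GradedAlgebra

variable (𝒜 : ℤ → Submodule K A) [GradedAlgebra 𝒜]

/-- The homogeneous components of a derivation of a `ℤ`-graded algebra. -/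
theorem exists_derivation_component (E : Derivation K A A) (i : ℤ) :
    ∃ D : Derivation K A A, ∀ m, ∀ f ∈ 𝒜 m, D f = GradedAlgebra.proj 𝒜 (m + i) (E f) := by
  obtain ⟨D, hD⟩ := GradedAlgebra.exists_derivation 𝒜
    (fun m => (GradedAlgebra.proj 𝒜 (m + i)).comp ((E : A →ₗ[K] A).comp (𝒜 m).subtype)) (by
      intro a b f g
      have h₁ : ((DirectSum.decompose 𝒜 ((f : A) * E g) (a + b + i) : 𝒜 (a + b + i)) : A)
          = f * DirectSum.decompose 𝒜 (E g) (b + i) := by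
        rw [add_assoc, DirectSum.coe_decompose_mul_add_of_left_mem 𝒜 f.2]
      have h₂ : ((DirectSum.decompose 𝒜 ((g : A) * E f) (a + b + i) : 𝒜 (a + b + i)) : A)
          = g * DirectSum.decompose 𝒜 (E f) (a + i) := by
        rw [add_comm a b, add_assoc, DirectSum.coe_decompose_mul_add_of_left_mem 𝒜 g.2]
      simp [-DirectSum.decompose_mul, GradedAlgebra.proj_apply, h₁, h₂])
  exact ⟨D, fun m f hf => hD m ⟨f, hf⟩⟩

theorem exists_forall_gt_proj_eq_zero (f : A) : ∃ N, ∀ l > N, GradedAlgebra.proj 𝒜 l f = 0 := by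
  classical
  obtain ⟨N, hN⟩ := (DirectSum.decompose 𝒜 f).support.bddAbove
  refine ⟨N, fun l hl => ?_⟩
  by_contra h
  refine hl.not_ge (hN ?_)
  rw [Finset.mem_coe, GradedRing.mem_support_iff]
  exact h

theorem proj_of_mem_ne {i j : ℤ} {f : A} (hf : f ∈ 𝒜 i) (h : i ≠ j) :
    GradedAlgebra.proj 𝒜 j f = 0 :=
  DirectSum.decompose_of_mem_ne 𝒜 hf h

theorem proj_mem (i : ℤ) (f : A) : GradedAlgebra.proj 𝒜 i f ∈ 𝒜 i :=
  (DirectSum.decompose 𝒜 f i).2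

variable {E : Derivation K A A} {C : ℤ → Derivation K A A}

theorem proj_derivation_apply
    (hC : ∀ i m, ∀ f ∈ 𝒜 m, C i f = GradedAlgebra.proj 𝒜 (m + i) (E f)) (l : ℤ) (h : A) :
    ∃ s : Finset ℤ, (∀ j ∉ s, GradedAlgebra.proj 𝒜 j h = 0) ∧
      GradedAlgebra.proj 𝒜 l (E h) = ∑ j ∈ s, C (l - j) (GradedAlgebra.proj 𝒜 j h) := by
  classical
  refine ⟨(DirectSum.decompose 𝒜 h).support, fun j hj => ?_, ?_⟩
  · by_contra h'
    exact hj ((GradedRing.mem_support_iff 𝒜 h j).2 h')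
  · conv_lhs => rw [← DirectSum.sum_support_decompose 𝒜 h]
    rw [map_sum, map_sum]
    refine Finset.sum_congr rfl fun j _ => ?_
    rw [hC _ j _ (proj_mem 𝒜 j h), add_sub_cancel]
    rfl

/-- A derivation is determined by its values on finitely many generators, and each generator sees
only boundedly many degrees. -/
theorem exists_forall_gt_component_eq_zero [Algebra.FiniteType K A]
    (hC : ∀ i m, ∀ f ∈ 𝒜 m, C i f = GradedAlgebra.proj 𝒜 (m + i) (E f)) :
    ∃ N, ∀ i > N, C i = 0 := by
  have key : ∀ f, ∃ N, ∀ i > N, C i f = 0 := by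
    intro f
    induction f using DirectSum.Decomposition.inductionOn 𝒜 with
    | zero => exact ⟨0, by simp⟩
    | @homogeneous m f =>
      obtain ⟨N, hN⟩ := exists_forall_gt_proj_eq_zero 𝒜 (E f)
      exact ⟨N - m, fun i hi => by rw [hC i m f f.2, hN _ (by linarith)]⟩
    | add f g hf hg =>
      obtain ⟨N, hN⟩ := hf
      obtain ⟨M, hM⟩ := hg
      refine ⟨max N M, fun i hi => ?_⟩
      rw [map_add, hN i (lt_of_le_of_lt (le_max_left _ _) hi),
        hM i (lt_of_le_of_lt (le_max_right _ _) hi), add_zero]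
  choose N hN using key
  obtain ⟨s, hs⟩ := Algebra.FiniteType.out (R := K) (A := A)
  obtain ⟨M, hM⟩ := (s.image N).bddAbove
  refine ⟨M, fun i hi => Derivation.ext_of_adjoin_eq_top s hs fun f hf => ?_⟩
  exact hN f i (lt_of_le_of_lt (hM (Finset.mem_coe.2 (Finset.mem_image_of_mem N hf))) hi)

/-- The component of highest degree of a derivation is locally nilpotent if this degree is positive
and the iterates of the derivation are of bounded degree. -/
theorem isLocallyNilpotent_of_top_component
    (hC : ∀ i m, ∀ f ∈ 𝒜 m, C i f = GradedAlgebra.proj 𝒜 (m + i) (E f))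
    (hE : ∀ f, ∃ N, ∀ q : ℕ, ∀ l > N, GradedAlgebra.proj 𝒜 l ((⇑E)^[q] f) = 0)
    {k : ℤ} (hk : 0 < k) (htop : ∀ i > k, C i = 0) : (C k).IsLocallyNilpotent := by
  intro f
  induction f using DirectSum.Decomposition.inductionOn 𝒜 with
  | zero => exact ⟨0, rfl⟩
  | add f g hf hg =>
    obtain ⟨a, ha⟩ := hf
    obtain ⟨b, hb⟩ := hg
    refine ⟨max a b, ?_⟩
    rw [iterate_map_add, Derivation.iterate_eq_zero_of_le ha (le_max_left _ _),
      Derivation.iterate_eq_zero_of_le hb (le_max_right _ _), add_zero]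
  | @homogeneous m f =>
    -- Each application of `E` raises the top degree by at most `k`, and only `C k` reaches the new
    -- top.
    have key : ∀ q : ℕ, (∀ l > m + q * k, GradedAlgebra.proj 𝒜 l ((⇑E)^[q] f) = 0) ∧
        GradedAlgebra.proj 𝒜 (m + q * k) ((⇑E)^[q] f) = (⇑(C k))^[q] f := by
      intro q
      induction q with
      | zero =>
        refine ⟨fun l hl => proj_of_mem_ne 𝒜 f.2 ?_, ?_⟩
        · rintro rfl
          simp at hl
        · simp
      | succ q ih =>
        obtain ⟨ih₁, ih₂⟩ := ih
        rw [Function.iterate_succ_apply', Function.iterate_succ_apply', ← ih₂]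
        have hz : ∀ l j : ℤ, l ≥ m + (q + 1 : ℕ) * k → (l ≠ m + (q + 1 : ℕ) * k ∨ j ≠ m + q * k) →
            C (l - j) (GradedAlgebra.proj 𝒜 j ((⇑E)^[q] f)) = 0 := by
          intro l j hl hj
          push_cast at hl hj
          by_cases hjm : j > m + q * k
          · rw [ih₁ j hjm, map_zero]
          · rw [htop, Derivation.zero_apply]
            by_contra hcon
            have : l - j = k := by linarith
            have : j = m + q * k := by linarith
            rcases hj with hj | hj
            · exact hj (by linarith)
            · exact hj this
        constructor
        · intro l hl
          obtain ⟨s, -, hs⟩ := proj_derivation_apply 𝒜 hC l ((⇑E)^[q] f)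
          rw [hs]
          exact Finset.sum_eq_zero fun j _ => hz l j hl.le (Or.inl hl.ne')
        · obtain ⟨s, hs', hs⟩ := proj_derivation_apply 𝒜 hC (m + (q + 1 : ℕ) * k) ((⇑E)^[q] f)
          rw [hs, Finset.sum_eq_single (m + q * k)]
          · congr 2
            push_cast
            ring
          · exact fun j _ hj => hz _ j le_rfl (Or.inr hj)
          · intro hns
            rw [hs' _ hns, map_zero]
    obtain ⟨N, hN⟩ := hE f
    -- As `k ≥ 1`, this many steps push the degree `m + q * k` beyond the bound `N`.
    refine ⟨(N - m + 1).toNat, ?_⟩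
    rw [← (key _).2]
    refine hN _ _ ?_
    have h₁ := Int.self_le_toNat (N - m + 1)
    have h₂ : (0 : ℤ) ≤ ((N - m + 1).toNat : ℤ) := Int.natCast_nonneg _
    nlinarith

end GradedAlgebra

namespace Derivation

variable {D E : Derivation K A A}

/-- The iterates of an eigenvector of `E` are multiples of it, so a bound for the degrees of the
eigenvector serves for all of them. -/
theorem IsIntegralSemisimple.exists_bound_iterate (hE : E.IsIntegralSemisimple)
    (𝒜 : ℤ → Submodule K A) [GradedAlgebra 𝒜] (f : A) :
    ∃ N, ∀ q : ℕ, ∀ l > N, GradedAlgebra.proj 𝒜 l ((⇑E)^[q] f) = 0 := by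
  have hf : f ∈ ⨆ m, E.weightSpace m := hE ▸ Submodule.mem_top
  induction hf using Submodule.iSup_induction' with
  | mem j f hf =>
    obtain ⟨N, hN⟩ := GradedAlgebra.exists_forall_gt_proj_eq_zero 𝒜 f
    refine ⟨N, fun q l hl => ?_⟩
    have : (⇑E)^[q] f = (j : K) ^ q • f := by
      induction q with
      | zero => simp
      | succ q ih => rw [Function.iterate_succ_apply', ih, map_smul, mem_weightSpace.1 hf,
          smul_smul, pow_succ]
    rw [this, _root_.map_smul, hN l hl, smul_zero]
  | zero => exact ⟨0, fun q l _ => by rw [iterate_map_zero, map_zero]⟩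
  | add f g _ _ hf hg =>
    obtain ⟨N, hN⟩ := hf
    obtain ⟨M, hM⟩ := hg
    refine ⟨max N M, fun q l hl => ?_⟩
    rw [iterate_map_add, map_add, hN q l (lt_of_le_of_lt (le_max_left _ _) hl),
      hM q l (lt_of_le_of_lt (le_max_right _ _) hl), add_zero]

/-- Otherwise the nonzero component of `E` of greatest degree would have positive degree, hence be
locally nilpotent. -/
theorem IsIntegralSemisimple.proj_eq_zero_of_pos [Algebra.FiniteType K A]
    (hrig : ∀ D : Derivation K A A, D.IsLocallyNilpotent → D = 0) (hE : E.IsIntegralSemisimple)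
    (𝒜 : ℤ → Submodule K A) [GradedAlgebra 𝒜] {m i : ℤ} (hi : 0 < i) {f : A} (hf : f ∈ 𝒜 m) :
    GradedAlgebra.proj 𝒜 (m + i) (E f) = 0 := by
  choose C hC using GradedAlgebra.exists_derivation_component 𝒜 E
  rw [← hC i m f hf]
  suffices C i = 0 by rw [this, zero_apply]
  by_contra hne
  obtain ⟨N, hN⟩ := GradedAlgebra.exists_forall_gt_component_eq_zero 𝒜 hC
  obtain ⟨k, hk, hmax⟩ := Int.exists_greatest_of_bdd (P := fun i => C i ≠ 0)
    ⟨N, fun z hz => by by_contra h; exact hz (hN z (not_le.1 h))⟩ ⟨i, hne⟩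
  refine hk (hrig _ (GradedAlgebra.isLocallyNilpotent_of_top_component 𝒜 hC
    (hE.exists_bound_iterate 𝒜) (hi.trans_le (hmax i hne)) fun j hj => ?_))
  by_contra h
  exact (hmax j h).not_gt hj

variable [CharZero K]

/-- The grading of an algebra by the weight spaces of a diagonalizable derivation. -/
noncomputable abbrev IsIntegralSemisimple.gradedAlgebra (hD : D.IsIntegralSemisimple) :
    GradedAlgebra D.weightSpace :=
  GradedAlgebra.ofIndep _ iSupIndep_weightSpace hD

theorem IsIntegralSemisimple.apply_mem_iSup_weightSpace_le [Algebra.FiniteType K A]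
    (hrig : ∀ D : Derivation K A A, D.IsLocallyNilpotent → D = 0) (hD : D.IsIntegralSemisimple)
    (hE : E.IsIntegralSemisimple) {m : ℤ} {f : A} (hf : f ∈ D.weightSpace m) :
    E f ∈ ⨆ j ≤ m, D.weightSpace j := by
  let := hD.gradedAlgebra
  classical
  rw [← DirectSum.sum_support_decompose D.weightSpace (E f)]
  refine Submodule.sum_mem _ fun j hj => ?_
  refine Submodule.mem_iSup_of_mem j (Submodule.mem_iSup_of_mem ?_
    (GradedAlgebra.proj_mem D.weightSpace j (E f)))
  by_contra! h
  rw [GradedRing.mem_support_iff] at hj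
  refine hj ?_
  simpa using hE.proj_eq_zero_of_pos hrig D.weightSpace (sub_pos.2 h) hf

theorem IsIntegralSemisimple.apply_mem_weightSpace [Algebra.FiniteType K A]
    (hrig : ∀ D : Derivation K A A, D.IsLocallyNilpotent → D = 0) (hD : D.IsIntegralSemisimple)
    (hE : E.IsIntegralSemisimple) {m : ℤ} {f : A} (hf : f ∈ D.weightSpace m) :
    E f ∈ D.weightSpace m := by
  have h₁ := hD.apply_mem_iSup_weightSpace_le hrig hE hf
  -- Passing to `-D` reverses the grading, so the upper bound becomes a lower bound.
  have h₂ := hD.neg.apply_mem_iSup_weightSpace_le (m := -m) hrig hE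
    (by rwa [weightSpace_neg, neg_neg])
  let := hD.gradedAlgebra
  have key : ∀ j ≠ m, GradedAlgebra.proj D.weightSpace j (E f) = 0 := by
    intro j hj
    rw [← LinearMap.mem_ker]
    rcases lt_or_gt_of_ne hj with h | h
    · refine (iSup₂_le fun i hi => ?_ : _ ≤ LinearMap.ker (GradedAlgebra.proj D.weightSpace j)) h₂
      rw [weightSpace_neg]
      exact fun g hg => GradedAlgebra.proj_of_mem_ne D.weightSpace hg (by lia)
    · exact (iSup₂_le fun i hi g hg => GradedAlgebra.proj_of_mem_ne D.weightSpace hg (by lia) :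
        _ ≤ LinearMap.ker (GradedAlgebra.proj D.weightSpace j)) h₁
  classical
  rw [← DirectSum.sum_support_decompose D.weightSpace (E f)]
  refine Submodule.sum_mem _ fun j _ => ?_
  by_cases h : j = m
  · exact h ▸ GradedAlgebra.proj_mem D.weightSpace j (E f)
  · change GradedAlgebra.proj D.weightSpace j (E f) ∈ _
    rw [key j h]
    exact Submodule.zero_mem _

/-- In the absence of locally nilpotent derivations, diagonalizable derivations with integral
eigenvalues commute. -/
theorem IsIntegralSemisimple.apply_comm [Algebra.FiniteType K A]
    (hrig : ∀ D : Derivation K A A, D.IsLocallyNilpotent → D = 0) (hD : D.IsIntegralSemisimple)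
    (hE : E.IsIntegralSemisimple) (f : A) : D (E f) = E (D f) := by
  have hf : f ∈ ⨆ m, D.weightSpace m := hD ▸ Submodule.mem_top
  induction hf using Submodule.iSup_induction' with
  | mem m f hf =>
    rw [mem_weightSpace.1 hf, map_smul,
      mem_weightSpace.1 (hD.apply_mem_weightSpace hrig hE hf)]
  | zero => simp
  | add f g _ _ hf hg => rw [map_add, map_add, hf, hg, map_add, map_add]

end Derivation

end HomogeneousComponents

/-! ### Simultaneous diagonalization -/

namespace Derivation

variable {K A : Type*} [Field K] [CommRing A] [Algebra K A]

variable {D : Derivation K A A}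

/-- Applying `D - i` removes the summand of weight `i` and rescales the others by nonzero factors,
so induction applies. -/
theorem mem_of_sum_mem [CharZero K] {p : Submodule K A} (hp : ∀ f ∈ p, D f ∈ p) (s : Finset ℤ)
    (g : ℤ → A) (hg : ∀ j ∈ s, g j ∈ D.weightSpace j) (h : ∑ j ∈ s, g j ∈ p) :
    ∀ j ∈ s, g j ∈ p := by
  induction s using Finset.induction_on generalizing g with
  | empty => simp
  | insert i s hi ih =>
    have h₁ : ∑ j ∈ s, ((j : K) - i) • g j ∈ p := by
      have h₂ := p.sub_mem (hp _ h) (p.smul_mem (i : K) h)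
      rw [Finset.sum_insert hi, map_add, map_sum, mem_weightSpace.1 (hg i (by simp)),
        smul_add, add_sub_add_left_eq_sub, Finset.smul_sum, ← Finset.sum_sub_distrib] at h₂
      refine (congrArg (· ∈ p) (Finset.sum_congr rfl fun j hj => ?_)).mp h₂
      rw [mem_weightSpace.1 (hg j (by simp [hj])), sub_smul]
    have h₃ : ∀ j ∈ s, g j ∈ p := by
      intro j hj
      have := ih (fun j => ((j : K) - i) • g j)
        (fun j hj => Submodule.smul_mem _ _ (hg j (by simp [hj]))) h₁ j hj
      refine (Submodule.smul_mem_iff _ ?_).1 this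
      rw [sub_ne_zero]
      exact_mod_cast fun h : j = i => hi (h ▸ hj)
    intro j hj
    rcases Finset.mem_insert.1 hj with rfl | hj
    · rw [Finset.sum_insert hi] at h
      exact (Submodule.add_mem_iff_left _ (Submodule.sum_mem _ h₃)).1 h
    · exact h₃ j hj

theorem IsIntegralSemisimple.mem_iSup_inf_weightSpace [CharZero K] (hD : D.IsIntegralSemisimple)
    {p : Submodule K A} (hp : ∀ f ∈ p, D f ∈ p) {f : A} (hf : f ∈ p) :
    f ∈ ⨆ j, p ⊓ D.weightSpace j := by
  classical
  let := hD.gradedAlgebra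
  rw [← DirectSum.sum_support_decompose D.weightSpace f] at hf ⊢
  refine Submodule.sum_mem _ fun j hj => Submodule.mem_iSup_of_mem j ⟨?_, ?_⟩
  · exact mem_of_sum_mem hp _ _ (fun j _ => GradedAlgebra.proj_mem D.weightSpace j _) hf j hj
  · exact GradedAlgebra.proj_mem D.weightSpace j _

/-- Simultaneous weight spaces of a set of derivations. -/
def jointWeightSpace (S : Set (Derivation K A A)) (w : S → ℤ) : Submodule K A :=
  ⨅ D : S, D.1.weightSpace (w D)

variable {S : Set (Derivation K A A)}

theorem mem_jointWeightSpace {w : S → ℤ} {f : A} :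
    f ∈ jointWeightSpace S w ↔ ∀ D : S, D.1 f = (w D : K) • f := by
  simp [jointWeightSpace, mem_weightSpace]

instance : SetLike.GradedMonoid (jointWeightSpace S) where
  one_mem := by
    simp only [jointWeightSpace, Submodule.mem_iInf]
    exact fun D => SetLike.GradedOne.one_mem (A := D.1.weightSpace)
  mul_mem {i j f g} hf hg := by
    simp only [jointWeightSpace, Submodule.mem_iInf] at *
    exact fun D => SetLike.mul_mem_graded (hf D) (hg D)

theorem iSupIndep_jointWeightSpace [CharZero K]
    (hcomm : ∀ D ∈ S, ∀ E ∈ S, ∀ f, D (E f) = E (D f)) : iSupIndep (jointWeightSpace S) := by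
  let F : S → Module.End K A := fun D => (D.1 : A →ₗ[K] A)
  have hF : ∀ D E, Commute (F D) (F E) := fun D E =>
    LinearMap.ext fun f => hcomm D.1 D.2 E.1 E.2 f
  have h := Module.End.independent_iInf_maxGenEigenspace_of_forall_mapsTo F
    (fun D E φ => Module.End.mapsTo_maxGenEigenspace_of_comm (hF E D) φ)
  refine (h.comp (f := fun (w : S → ℤ) D => (w D : K)) ?_).mono ?_
  · intro w w' hww
    exact funext fun D => Int.cast_injective (congrFun hww D)
  · exact fun w => iInf_mono fun D => ((F D).genEigenspace _).monotone le_top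

/-- By commutation, each additional derivation preserves the joint weight spaces already found and
hence splits them further. -/
theorem iSup_iInf_weightSpace_eq_top [CharZero K] (B : Finset (Derivation K A A))
    (hss : ∀ D ∈ B, D.IsIntegralSemisimple)
    (hcomm : ∀ D ∈ B, ∀ E ∈ B, ∀ f, D (E f) = E (D f)) :
    ⨆ w : Derivation K A A → ℤ, ⨅ D ∈ B, D.weightSpace (w D) = ⊤ := by
  classical
  induction B using Finset.induction_on with
  | empty => simp
  | insert E B hE ih =>
    rw [eq_top_iff, ← ih (fun D hD => hss D (by simp [hD]))
      (fun D hD E hE => hcomm D (by simp [hD]) E (by simp [hE]))]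
    refine iSup_le fun w f hf => ?_
    have hp : ∀ f ∈ ⨅ D ∈ B, D.weightSpace (w D), E f ∈ ⨅ D ∈ B, D.weightSpace (w D) := by
      intro f hf
      simp only [Submodule.mem_iInf, mem_weightSpace] at hf ⊢
      intro D hD
      rw [hcomm D (by simp [hD]) E (by simp), hf D hD, map_smul]
    refine SetLike.le_def.1 (iSup_le fun j => ?_)
      ((hss E (by simp)).mem_iSup_inf_weightSpace hp hf)
    refine le_trans ?_ (le_iSup _ (Function.update w E j))
    rw [Finset.iInf_insert, Function.update_self, inf_comm]
    refine inf_le_inf_left _ (iInf₂_mono fun D hD => ?_)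
    rw [Function.update_of_ne]
    rintro rfl
    exact hE hD

/-- Evaluation on finitely many generators embeds the derivations into a finite free module over a
Noetherian ring. -/
instance isNoetherian [Algebra.FiniteType K A] : IsNoetherian A (Derivation K A A) := by
  have := Algebra.FiniteType.isNoetherianRing K A
  obtain ⟨s, hs⟩ := Algebra.FiniteType.out (R := K) (A := A)
  let ev : Derivation K A A →ₗ[A] (s → A) :=
    { toFun := fun D f => D f
      map_add' := fun D E => rfl
      map_smul' := fun a D => rfl }
  refine isNoetherian_of_injective ev fun D E h => ext_of_adjoin_eq_top s hs fun f hf => ?_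
  exact congrFun h ⟨f, hf⟩

/-- Commuting diagonalizable derivations with integral eigenvalues of an integral domain of finite
type are simultaneously diagonalizable. -/
theorem iSup_jointWeightSpace_eq_top [CharZero K] [IsDomain A] [Algebra.FiniteType K A]
    (hss : ∀ D ∈ S, D.IsIntegralSemisimple)
    (hcomm : ∀ D ∈ S, ∀ E ∈ S, ∀ f, D (E f) = E (D f)) :
    ⨆ w, jointWeightSpace S w = ⊤ := by
  obtain ⟨B, hB, hspan⟩ := (Submodule.fg_span_iff_fg_span_finset_subset S).1
    (IsNoetherian.noetherian (Submodule.span A S))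
  rw [eq_top_iff, ← iSup_iInf_weightSpace_eq_top B (fun D hD => hss D (hB hD))
    (fun D hD E hE => hcomm D (hB hD) E (hB hE))]
  refine iSup_le fun w => ?_
  set p := ⨅ D ∈ B, D.weightSpace (w D) with hp
  -- An `A`-combination of elements of `B`, each scalar on `p`, acts on `p` as multiplication by one
  -- element of `A`.
  have hscalar : ∀ E ∈ Submodule.span A S, ∃ c : A, ∀ f ∈ p, E f = c * f := by
    intro E hE
    rw [hspan] at hE
    induction hE using Submodule.span_induction with
    | mem D hD =>
      refine ⟨algebraMap K A (w D), fun f hf => ?_⟩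
      simp only [hp, Submodule.mem_iInf, mem_weightSpace] at hf
      rw [hf D hD, Algebra.smul_def]
    | zero => exact ⟨0, by simp⟩
    | add D E _ _ hD hE =>
      obtain ⟨c, hc⟩ := hD
      obtain ⟨d, hd⟩ := hE
      exact ⟨c + d, fun f hf => by rw [add_apply, hc f hf, hd f hf, add_mul]⟩
    | smul a D _ hD =>
      obtain ⟨c, hc⟩ := hD
      exact ⟨a * c, fun f hf => by rw [smul_apply, hc f hf, smul_eq_mul, mul_assoc]⟩
  have hweight : ∀ E : S, ∃ j : ℤ, ∀ f ∈ p, E.1 f = (j : K) • f := by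
    intro E
    obtain ⟨c, hc⟩ := hscalar E (Submodule.subset_span E.2)
    have hstable : ∀ f ∈ p, E.1 f ∈ p := by
      intro f hf
      simp only [hp, Submodule.mem_iInf, mem_weightSpace] at hf ⊢
      intro D hD
      rw [hcomm D (hB hD) E E.2, hf D hD, map_smul]
    -- A nonzero eigenvector of `E` in `p` can be cancelled in the domain `A`, forcing the
    -- multiplier `c` to be an integer. Without one, `p` is zero and any weight will do.
    by_cases hbot : ∃ j, p ⊓ E.1.weightSpace j ≠ ⊥
    · obtain ⟨j, hj⟩ := hbot
      obtain ⟨h, ⟨hhp, hhj⟩, hne⟩ := Submodule.exists_mem_ne_zero_of_ne_bot hj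
      have : c = algebraMap K A j := by
        refine mul_right_cancel₀ hne ?_
        rw [← hc h hhp, ← Algebra.smul_def]
        exact mem_weightSpace.1 hhj
      exact ⟨j, fun f hf => by rw [hc f hf, this, Algebra.smul_def]⟩
    · push Not at hbot
      refine ⟨0, fun f hf => ?_⟩
      have := (hss E E.2).mem_iSup_inf_weightSpace hstable hf
      simp only [hbot, iSup_bot, Submodule.mem_bot] at this
      simp [this]
  choose v hv using hweight
  exact fun f hf => Submodule.mem_iSup_of_mem v (mem_jointWeightSpace.2 fun D => hv D f hf)

end Derivation

/-! ### The weight lattice -/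

namespace Derivation

variable {K A : Type*} [Field K] [CommRing A] [Algebra K A]

/-- A set of commuting diagonalizable derivations with integral eigenvalues of an integral domain of
finite type is induced by a grading by a lattice that is generated by the weights. -/
theorem exists_lattice_grading [CharZero K] [IsDomain A] [Algebra.FiniteType K A]
    {S : Set (Derivation K A A)} (hss : ∀ D ∈ S, D.IsIntegralSemisimple)
    (hcomm : ∀ D ∈ S, ∀ E ∈ S, ∀ f, D (E f) = E (D f)) :
    ∃ (r : ℕ) (𝒜 : (Fin r → ℤ) → Submodule K A), Nonempty (GradedAlgebra 𝒜) ∧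
      (∀ D ∈ S, ∃ b : Fin r → ℤ, ∀ m, ∀ f ∈ 𝒜 m, D f = ((∑ i, b i * m i : ℤ) : K) • f) ∧
      Submodule.span ℤ {m | 𝒜 m ≠ ⊥} = ⊤ := by
  classical
  have hind := iSupIndep_jointWeightSpace hcomm
  let : GradedAlgebra (jointWeightSpace S) :=
    GradedAlgebra.ofIndep _ hind (iSup_jointWeightSpace_eq_top hss hcomm)
  obtain ⟨s, hs⟩ := Algebra.FiniteType.out (R := K) (A := A)
  -- The weights of the algebra generators generate a finitely generated, torsion-free, hence free
  -- group, although `S` may be infinite.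
  let T : Finset (S → ℤ) := s.biUnion fun x => (DirectSum.decompose (jointWeightSpace S) x).support
  let M : Submodule ℤ (S → ℤ) := Submodule.span ℤ T
  have : Module.Finite ℤ M := Module.Finite.span_finset ℤ T
  let e : M ≃ₗ[ℤ] (Fin (Module.finrank ℤ M) → ℤ) := (Module.finBasis ℤ M).equivFun
  let 𝒜 : (Fin (Module.finrank ℤ M) → ℤ) → Submodule K A := fun m => jointWeightSpace S (e.symm m)
  have hgm : SetLike.GradedMonoid 𝒜 :=
    { one_mem := by
        simp only [𝒜, map_zero]
        exact SetLike.GradedOne.one_mem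
      mul_mem := fun i j f g hf hg => by
        simp only [𝒜, map_add]
        exact SetLike.mul_mem_graded hf hg }
  have hsup : iSup 𝒜 = ⊤ := by
    rw [Submodule.iSup_eq_toSubmodule_range, Algebra.toSubmodule_eq_top, ← top_le_iff, ← hs,
      Algebra.adjoin_le_iff]
    intro x hx
    rw [SetLike.mem_coe, ← Subalgebra.mem_toSubmodule, ← Submodule.iSup_eq_toSubmodule_range,
      ← DirectSum.sum_support_decompose (jointWeightSpace S) x]
    refine Submodule.sum_mem _ fun w hw => ?_
    have hwM : w ∈ M := Submodule.subset_span (Finset.mem_coe.2 (Finset.mem_biUnion.2 ⟨x, hx, hw⟩))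
    refine Submodule.mem_iSup_of_mem (e ⟨w, hwM⟩) ?_
    simp only [LinearEquiv.symm_apply_apply]
    exact (DirectSum.decompose (jointWeightSpace S) x w).2
  have hinj : Function.Injective fun m => ((e.symm m : M) : S → ℤ) :=
    Subtype.val_injective.comp e.symm.injective
  refine ⟨_, 𝒜, ⟨GradedAlgebra.ofIndep 𝒜 (hind.comp hinj) hsup⟩, ?_, ?_⟩
  · intro D hD
    -- The eigenvalue of `D` is linear in the weight; `b` lists its values on the chosen lattice
    -- basis.
    refine ⟨fun i => (e.symm (fun j => if i = j then 1 else 0) : M).1 ⟨D, hD⟩, fun m f hf => ?_⟩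
    rw [mem_jointWeightSpace.1 hf ⟨D, hD⟩]
    congr 2
    let ℓ : (Fin (Module.finrank ℤ M) → ℤ) →ₗ[ℤ] ℤ :=
      (LinearMap.proj (⟨D, hD⟩ : S)).comp (M.subtype.comp e.symm.toLinearMap)
    refine (LinearMap.pi_apply_eq_sum_univ ℓ m).trans (Finset.sum_congr rfl fun i _ => ?_)
    rw [smul_eq_mul, mul_comm]
    rfl
  · rw [eq_top_iff]
    intro m _
    obtain ⟨⟨w, hw⟩, rfl⟩ := e.surjective m
    induction hw using Submodule.span_induction with
    | mem w hw =>
      obtain ⟨x, hx, hw'⟩ := Finset.mem_biUnion.1 (Finset.mem_coe.1 hw)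
      refine Submodule.subset_span ?_
      rw [GradedRing.mem_support_iff] at hw'
      refine (Submodule.ne_bot_iff _).2 ⟨_, ?_, hw'⟩
      simp only [𝒜, LinearEquiv.symm_apply_apply]
      exact (DirectSum.decompose (jointWeightSpace S) x w).2
    | zero => exact (map_zero e) ▸ Submodule.zero_mem _
    | add v w hv hw h₁ h₂ =>
      have := Submodule.add_mem _ (h₁ trivial) (h₂ trivial)
      rwa [← map_add] at this
    | smul a w hw h =>
      have := Submodule.smul_mem _ a (h trivial)
      rwa [← _root_.map_smul] at this

end Derivation

/-! ### Exponentials of locally nilpotent derivations -/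

theorem Polynomial.coeff_succ_eq_of_coeff_derivative_eq {R : Type*} [CommRing R] [IsDomain R]
    [CharZero R] {P Q : Polynomial R} {k : ℕ}
    (h : (derivative P).coeff k = (derivative Q).coeff k) : P.coeff (k + 1) = Q.coeff (k + 1) := by
  rw [coeff_derivative, coeff_derivative] at h
  exact mul_right_cancel₀ (Nat.cast_add_one_ne_zero k) h

namespace Derivation

open Polynomial

variable {K A : Type*} [Field K] [CommRing A] [Algebra K A] {D : Derivation K A A}

theorem IsLocallyNilpotent.exists_expPolynomial (hD : D.IsLocallyNilpotent) (f : A) :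
    ∃ P : A[X], ∀ k, P.coeff k = ((k.factorial : K)⁻¹) • (⇑D)^[k] f := by
  obtain ⟨n, hn⟩ := hD f
  refine ⟨∑ k ∈ Finset.range n, monomial k (((k.factorial : K)⁻¹) • (⇑D)^[k] f), fun k => ?_⟩
  simp only [finsetSum_coeff, coeff_monomial, Finset.sum_ite_eq', Finset.mem_range]
  split_ifs with h
  · rfl
  · rw [iterate_eq_zero_of_le hn (not_lt.1 h), smul_zero]

/-- The exponential `∑ Dᵏ f / k! Xᵏ` of a locally nilpotent derivation. -/
noncomputable def IsLocallyNilpotent.expPolynomial (hD : D.IsLocallyNilpotent) (f : A) : A[X] :=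
  (hD.exists_expPolynomial f).choose

variable (hD : D.IsLocallyNilpotent)

namespace IsLocallyNilpotent

theorem coeff_expPolynomial (f : A) (k : ℕ) :
    (hD.expPolynomial f).coeff k = ((k.factorial : K)⁻¹) • (⇑D)^[k] f :=
  (hD.exists_expPolynomial f).choose_spec k

theorem coeff_zero_expPolynomial (f : A) : (hD.expPolynomial f).coeff 0 = f := by
  simp [coeff_expPolynomial]

theorem coeff_one_expPolynomial (f : A) : (hD.expPolynomial f).coeff 1 = D f := by
  simp [coeff_expPolynomial]

theorem expPolynomial_add (f g : A) :
    hD.expPolynomial (f + g) = hD.expPolynomial f + hD.expPolynomial g := by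
  ext k
  simp [coeff_expPolynomial, iterate_map_add]

theorem expPolynomial_algebraMap (c : K) :
    hD.expPolynomial (algebraMap K A c) = C (algebraMap K A c) := by
  ext k
  cases k with
  | zero => simp [coeff_expPolynomial]
  | succ k => simp [coeff_expPolynomial, iterate_map_zero]

theorem apply_eval_expPolynomial (f : A) (s : K) :
    D ((hD.expPolynomial f).eval (algebraMap K A s)) =
      (hD.expPolynomial (D f)).eval (algebraMap K A s) := by
  set n := max (hD.expPolynomial f).natDegree (hD.expPolynomial (D f)).natDegree + 1
  rw [eval_eq_sum_range' (n := n) (by lia), eval_eq_sum_range' (n := n) (by lia), map_sum]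
  refine Finset.sum_congr rfl fun k _ => ?_
  have h : D ((hD.expPolynomial f).coeff k) = (hD.expPolynomial (D f)).coeff k := by
    rw [coeff_expPolynomial, coeff_expPolynomial, D.map_smul, ← Function.iterate_succ_apply,
      Function.iterate_succ_apply']
  rw [← map_pow, mul_comm, ← Algebra.smul_def, D.map_smul, h, mul_comm, ← Algebra.smul_def]

variable [CharZero K]

theorem derivative_expPolynomial (f : A) :
    derivative (hD.expPolynomial f) = hD.expPolynomial (D f) := by
  ext k
  have hk : (k + 1 : K) ≠ 0 := Nat.cast_add_one_ne_zero k
  have h : ((k : A) + 1) = algebraMap K A (k + 1) := by simp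
  rw [coeff_derivative, coeff_expPolynomial, coeff_expPolynomial, ← Function.iterate_succ_apply, h,
    mul_comm, ← Algebra.smul_def, smul_smul]
  congr 1
  rw [Nat.factorial_succ]
  push_cast
  field_simp

variable [IsDomain A]

/-- Both sides have the same constant term, and by the Leibniz rule their derivatives satisfy the
same recursion. -/
theorem expPolynomial_mul (f g : A) :
    hD.expPolynomial (f * g) = hD.expPolynomial f * hD.expPolynomial g := by
  have := charZero_of_injective_algebraMap (algebraMap K A).injective
  ext k
  induction k generalizing f g with
  | zero => simp [coeff_zero_expPolynomial, mul_coeff_zero]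
  | succ k ih =>
    apply coeff_succ_eq_of_coeff_derivative_eq
    simp only [derivative_expPolynomial, derivative_mul, D.leibniz, expPolynomial_add, coeff_add,
      smul_eq_mul, ih]
    rw [mul_comm (hD.expPolynomial g), add_comm]

/-- This is $e^{XD}e^{sD}=e^{(X+s)D}$, the source of the group law, again proved by comparing
constant terms and derivatives. -/
theorem expPolynomial_eval (f : A) (s : K) :
    hD.expPolynomial ((hD.expPolynomial f).eval (algebraMap K A s)) =
      taylor (algebraMap K A s) (hD.expPolynomial f) := by
  have := charZero_of_injective_algebraMap (algebraMap K A).injective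
  ext k
  induction k generalizing f with
  | zero => simp [coeff_zero_expPolynomial, taylor_coeff_zero]
  | succ k ih =>
    apply coeff_succ_eq_of_coeff_derivative_eq
    rw [derivative_expPolynomial, apply_eval_expPolynomial, ih, ← derivative_expPolynomial]
    simp [taylor_apply, derivative_comp]

/-- The one-parameter group of algebra automorphisms given by the exponentials of the multiples of
a locally nilpotent derivation. -/
noncomputable def exp : Multiplicative K →* (A →ₐ[K] A) where
  toFun s :=
    { toFun := fun f => (hD.expPolynomial f).eval (algebraMap K A s.toAdd)
      map_one' := by rw [← map_one (algebraMap K A), expPolynomial_algebraMap, eval_C]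
      map_mul' := fun f g => by rw [expPolynomial_mul, eval_mul]
      map_zero' := by rw [← map_zero (algebraMap K A), expPolynomial_algebraMap, eval_C]
      map_add' := fun f g => by rw [expPolynomial_add, eval_add]
      commutes' := fun c => by rw [expPolynomial_algebraMap, eval_C] }
  map_one' := by
    ext f
    simp [← coeff_zero_eq_eval_zero, coeff_zero_expPolynomial]
  map_mul' s t := by
    ext f
    simp [expPolynomial_eval, taylor_eval]

theorem exp_apply (s : Multiplicative K) (f : A) :
    hD.exp s f = (hD.expPolynomial f).eval (algebraMap K A s.toAdd) :=
  rfl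

end IsLocallyNilpotent

end Derivation

/-! ### Coordinate rings, automorphisms and rigidity -/

namespace ClassicalVariety

open MvPolynomial

variable {K : Type*} [Field K] {σ : Type*} {X : Set (σ → K)}

theorem eval_bind₁ {α β : Type*} (c : β → K) (F : α → MvPolynomial β K) (p : MvPolynomial α K) :
    eval c (bind₁ F p) = eval (fun a => eval c (F a)) p :=
  eval₂Hom_bind₁ (RingHom.id K) c F p

/-- The algebra of regular functions on `X`. -/
def coordinateRing (X : Set (σ → K)) : Subalgebra K (X → K) where
  carrier := {f | IsRegularFun (fun x : X => x.1) f}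
  mul_mem' := fun ⟨p, hp⟩ ⟨q, hq⟩ => ⟨p * q, fun x => by simp [hp, hq]⟩
  add_mem' := fun ⟨p, hp⟩ ⟨q, hq⟩ => ⟨p + q, fun x => by simp [hp, hq]⟩
  algebraMap_mem' c := ⟨C c, fun x => by simp⟩

theorem mem_coordinateRing {f : X → K} :
    f ∈ coordinateRing X ↔ IsRegularFun (fun x : X => x.1) f :=
  Iff.rfl

/-- Evaluation of regular functions at a point. -/
def evalAt (x : X) : coordinateRing X →ₐ[K] K :=
  (Pi.evalAlgHom K (fun _ : X => K) x).comp (coordinateRing X).val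

theorem evalAt_apply (x : X) (f : coordinateRing X) : evalAt x f = f.1 x :=
  rfl

theorem exists_polynomial (f : coordinateRing X) :
    ∃ p : MvPolynomial σ K, ∀ x : X, f.1 x = eval x.1 p :=
  mem_coordinateRing.1 f.2

/-- The coordinate functions on `X`. -/
noncomputable def coordinate (X : Set (σ → K)) (i : σ) : coordinateRing X :=
  ⟨fun x => x.1 i, mem_coordinateRing.2 ⟨MvPolynomial.X i, fun x => by simp⟩⟩

theorem coordinate_apply (i : σ) (x : X) : (coordinate X i).1 x = x.1 i :=
  rfl

theorem coe_aeval_coordinate_apply (p : MvPolynomial σ K) (x : X) :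
    (aeval (coordinate X) p).1 x = eval x.1 p := by
  have h : (evalAt x).comp (aeval (coordinate X)) = aeval x.1 := by
    ext i
    simp [evalAt_apply, coordinate_apply]
  exact DFunLike.congr_fun h p

theorem aeval_coordinate_surjective :
    Function.Surjective (aeval (coordinate X) : MvPolynomial σ K →ₐ[K] coordinateRing X) := by
  intro f
  obtain ⟨p, hp⟩ := exists_polynomial f
  refine ⟨p, Subtype.ext (funext fun x => ?_)⟩
  rw [coe_aeval_coordinate_apply, hp x]

theorem adjoin_range_coordinate : Algebra.adjoin K (Set.range (coordinate X)) = ⊤ := by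
  rw [Algebra.adjoin_range_eq_range_aeval]
  exact (AlgHom.range_eq_top _).2 aeval_coordinate_surjective

instance [Finite σ] : Algebra.FiniteType K (coordinateRing X) :=
  Algebra.FiniteType.of_surjective _ aeval_coordinate_surjective

theorem isZariskiClosed_setOf_eval_eq_zero (p : MvPolynomial σ K) :
    IsZariskiClosed {x | eval x p = 0} :=
  ⟨Ideal.span {p}, by ext x; simp [zeroLocus_span]⟩

theorem IsIrreducibleAffineVariety.isDomain (hX : IsIrreducibleAffineVariety X) :
    IsDomain (coordinateRing X) := by
  have : Nonempty X := hX.nonempty.to_subtype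
  have : NoZeroDivisors (coordinateRing X) := by
    refine ⟨fun {f g} hfg => ?_⟩
    obtain ⟨p, hp⟩ := exists_polynomial f
    obtain ⟨q, hq⟩ := exists_polynomial g
    refine (hX.irreducible _ _ (isZariskiClosed_setOf_eval_eq_zero p)
      (isZariskiClosed_setOf_eval_eq_zero q) fun x hx => ?_).imp (fun h => ?_) fun h => ?_
    · have : f.1 ⟨x, hx⟩ * g.1 ⟨x, hx⟩ = 0 := congrFun (congrArg Subtype.val hfg) ⟨x, hx⟩
      rw [hp, hq] at this
      exact mul_eq_zero.1 this
    · exact Subtype.ext (funext fun x => (hp x).trans (h x.2))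
    · exact Subtype.ext (funext fun x => (hq x).trans (h x.2))
  exact NoZeroDivisors.to_isDomain _

/-- The algebra endomorphism induced by an automorphism. -/
noncomputable def pullback (g : AutGroup X) : coordinateRing X →ₐ[K] coordinateRing X where
  toFun f := ⟨fun x => f.1 (g.1 x), by
    obtain ⟨p, hp⟩ := exists_polynomial f
    choose q hq using g.2.1
    refine mem_coordinateRing.2 ⟨bind₁ q p, fun x => ?_⟩
    have h : (g.1 x).1 = fun i => eval x.1 (q i) := funext fun i => hq i x
    refine (hp _).trans ?_
    rw [h]
    exact (eval_bind₁ _ q p).symm⟩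
  map_one' := rfl
  map_mul' _ _ := rfl
  map_zero' := rfl
  map_add' _ _ := rfl
  commutes' _ := rfl

theorem pullback_apply (g : AutGroup X) (f : coordinateRing X) (x : X) :
    (pullback g f).1 x = f.1 (g.1 x) :=
  rfl

theorem pullback_injective :
    Function.Injective (pullback : AutGroup X → coordinateRing X →ₐ[K] coordinateRing X) := by
  intro g h hgh
  refine Subtype.ext (Equiv.ext fun x => Subtype.ext (funext fun i => ?_))
  exact congrFun (congrArg Subtype.val (DFunLike.congr_fun hgh (coordinate X i))) x

theorem algHom_apply_eq_eval (T : coordinateRing X →ₐ[K] coordinateRing X)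
    (p : MvPolynomial σ K) (x : X) :
    (T (aeval (coordinate X) p)).1 x = eval (fun i => (T (coordinate X i)).1 x) p := by
  have h : ((evalAt x).comp T).comp (aeval (coordinate X)) = aeval fun i => (T (coordinate X i)).1 x := by
    ext i
    simp [evalAt_apply]
  exact DFunLike.congr_fun h p

/-- The point map induced by an endomorphism of the coordinate ring. -/
noncomputable def pointMap (hX : IsZariskiClosed X)
    (T : coordinateRing X →ₐ[K] coordinateRing X) (x : X) : X :=
  ⟨fun i => (T (coordinate X i)).1 x, by
    obtain ⟨I, hI⟩ := hX
    have hx : ∀ p ∈ I, (T (aeval (coordinate X) p)).1 x = 0 := by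
      intro p hp
      have : aeval (coordinate X) p = 0 := by
        refine Subtype.ext (funext fun y => (coe_aeval_coordinate_apply p y).trans ?_)
        have hy : y.1 ∈ zeroLocus K I := hI ▸ y.2
        simpa using hy p hp
      rw [this, map_zero]
      rfl
    have : (fun i => (T (coordinate X i)).1 x) ∈ zeroLocus K I := by
      intro p hp
      simpa [algHom_apply_eq_eval] using hx p hp
    rwa [← hI] at this⟩

theorem apply_pointMap (hX : IsZariskiClosed X) (T : coordinateRing X →ₐ[K] coordinateRing X)
    (f : coordinateRing X) (x : X) : f.1 (pointMap hX T x) = (T f).1 x := by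
  obtain ⟨p, rfl⟩ := aeval_coordinate_surjective f
  rw [algHom_apply_eq_eval, coe_aeval_coordinate_apply]
  rfl

theorem pointMap_one (hX : IsZariskiClosed X) (x : X) : pointMap hX 1 x = x :=
  rfl

/-- The order is reversed by contravariance, which is harmless for the commutative groups considered
below. -/
theorem pointMap_mul (hX : IsZariskiClosed X) (S T : coordinateRing X →ₐ[K] coordinateRing X)
    (x : X) : pointMap hX (S * T) x = pointMap hX T (pointMap hX S x) := by
  refine Subtype.ext (funext fun i => ?_)
  exact (apply_pointMap hX S (T (coordinate X i)) x).symm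

theorem isMorphism_pointMap (hX : IsZariskiClosed X)
    (T : coordinateRing X →ₐ[K] coordinateRing X) : IsMorphism (pointMap hX T) :=
  fun j => mem_coordinateRing.1 (T (coordinate X j)).2

/-- An action of a commutative group on the coordinate ring induces an action on the variety. -/
noncomputable def actionOfAlgHom {G : Type*} [CommGroup G] (hX : IsZariskiClosed X)
    (ψ : G →* (coordinateRing X →ₐ[K] coordinateRing X)) : G →* AutGroup X where
  toFun g := ⟨⟨pointMap hX (ψ g), pointMap hX (ψ g⁻¹),
      fun x => by rw [← pointMap_mul, ← map_mul, mul_inv_cancel, map_one, pointMap_one],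
      fun x => by rw [← pointMap_mul, ← map_mul, inv_mul_cancel, map_one, pointMap_one]⟩,
    isMorphism_pointMap hX (ψ g), isMorphism_pointMap hX (ψ g⁻¹)⟩
  map_one' := Subtype.ext (Equiv.ext fun x => by
    change pointMap hX (ψ 1) x = x
    rw [map_one, pointMap_one])
  map_mul' g h := Subtype.ext (Equiv.ext fun x => by
    change pointMap hX (ψ (g * h)) x = pointMap hX (ψ g) (pointMap hX (ψ h) x)
    rw [mul_comm, map_mul, pointMap_mul])

theorem pullback_actionOfAlgHom {G : Type*} [CommGroup G] (hX : IsZariskiClosed X)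
    (ψ : G →* (coordinateRing X →ₐ[K] coordinateRing X)) (g : G) :
    pullback (actionOfAlgHom hX ψ g) = ψ g :=
  AlgHom.ext fun f => Subtype.ext (funext fun x => apply_pointMap hX (ψ g) f x)

/-- A rigid variety has no nonzero locally nilpotent derivations. -/
theorem IsRigid.derivation_eq_zero [CharZero K] [IsDomain (coordinateRing X)] (hrigid : IsRigid X)
    (hX : IsZariskiClosed X) (D : Derivation K (coordinateRing X) (coordinateRing X))
    (hD : D.IsLocallyNilpotent) : D = 0 := by
  have hreg : IsRegularAction gaCoord (actionOfAlgHom hX hD.exp) := by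
    intro j
    choose p hp using fun k => exists_polynomial ((hD.expPolynomial (coordinate X j)).coeff k)
    refine ⟨∑ k ∈ Finset.range ((hD.expPolynomial (coordinate X j)).natDegree + 1),
      rename Sum.inr (p k) * MvPolynomial.X (Sum.inl ()) ^ k, fun ⟨s, x⟩ => ?_⟩
    change (hD.exp s (coordinate X j)).1 x = _
    rw [hD.exp_apply, Polynomial.eval_eq_sum_range]
    simp only [AddSubmonoidClass.coe_finsetSum, Finset.sum_apply, map_sum, map_mul, map_pow,
      eval_X, eval_rename, Sum.elim_inl]
    refine Finset.sum_congr rfl fun k _ => ?_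
    change ((hD.expPolynomial (coordinate X j)).coeff k).1 x * s.toAdd ^ k = _
    rw [hp k x]
    rfl
  have htriv := hrigid _ hreg
  refine Derivation.ext_of_adjoin_eq_top _ adjoin_range_coordinate ?_
  rintro _ ⟨j, rfl⟩
  refine Subtype.ext (funext fun x => ?_)
  let ev : coordinateRing X →+* K := (evalAt x).toRingHom
  -- Triviality of the action makes this polynomial in `s` constant on the infinite field `K`; its
  -- linear coefficient is the value of `D` on the coordinate.
  have h : (hD.expPolynomial (coordinate X j)).map ev = Polynomial.C (x.1 j) := by
    refine Polynomial.funext fun s => ?_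
    have h₁ : (hD.exp (Multiplicative.ofAdd s) (coordinate X j)).1 x = x.1 j := by
      rw [← pullback_actionOfAlgHom hX, htriv]
      rfl
    rw [hD.exp_apply] at h₁
    rw [Polynomial.eval_C, ← h₁]
    exact (Polynomial.eval_map_apply ev (algebraMap K _ s)).trans rfl
  have h₂ := congrArg (fun P => P.coeff 1) h
  simp only [Polynomial.coeff_map, hD.coeff_one_expPolynomial, Polynomial.coeff_C] at h₂
  exact h₂

end ClassicalVariety

/-! ### Infinitesimal generators of torus actions -/

namespace ClassicalVariety

open MvPolynomial

section Characters

variable {K : Type*} [Field K] [CharZero K]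

/-- In characteristic zero `2` has infinite order, so this one element separates all integral
weights. -/
theorem two_zpow_injective : Function.Injective fun m : ℤ => (2 : K) ^ m := by
  intro m n h
  refine zpow_right_injective₀ (a := (2 : ℚ)) (by norm_num) (by norm_num) ?_
  have : ((2 ^ m : ℚ) : K) = ((2 ^ n : ℚ) : K) := by
    push_cast
    exact h
  exact_mod_cast this

/-- Laurent polynomials are determined by their values. -/
theorem eq_zero_of_forall_sum_zpow_eq_zero (s : Finset ℤ) (c : ℤ → K)
    (h : ∀ t : Kˣ, ∑ m ∈ s, ((t ^ m : Kˣ) : K) * c m = 0) : ∀ m ∈ s, c m = 0 := by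
  let χ : ℤ → Kˣ →* K := fun m => (Units.coeHom K).comp (zpowGroupHom m)
  have hχ : Function.Injective χ := by
    intro m n hmn
    have := DFunLike.congr_fun hmn (Units.mk0 (2 : K) two_ne_zero)
    exact two_zpow_injective (K := K) (by simpa [χ] using this)
  have hli := (linearIndependent_monoidHom Kˣ K).comp χ hχ
  refine linearIndependent_iff'.1 hli s c (funext fun t => ?_)
  have := h t
  simp only [Finset.sum_apply, Pi.smul_apply, smul_eq_mul, Pi.zero_apply]
  rw [← this]
  exact Finset.sum_congr rfl fun m _ => mul_comm _ _

end Characters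

variable {K : Type*} [Field K] {σ : Type*} {X : Set (σ → K)} {r : ℕ}

open LaurentPolynomial in
-- On the `i`-th factor of the torus, its two coordinates become `T` and `T⁻¹`, and all other torus
-- coordinates become `1`.
theorem exists_laurentPolynomial (P : MvPolynomial ((Fin r ⊕ Fin r) ⊕ σ) K) (i : Fin r) :
    ∃ q : (coordinateRing X)[T;T⁻¹], ∀ (t : Kˣ) (x : X),
      eval (Sum.elim (torusCoord (Pi.mulSingle i t)) x.1) P =
        LaurentPolynomial.eval₂ (evalAt x : coordinateRing X →+* K) t q := by
  induction P using MvPolynomial.induction_on with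
  | C c =>
    refine ⟨LaurentPolynomial.C (algebraMap K _ c), fun t x => ?_⟩
    simp
  | add p q hp hq =>
    obtain ⟨p', hp⟩ := hp
    obtain ⟨q', hq⟩ := hq
    exact ⟨p' + q', fun t x => by rw [map_add, map_add, hp, hq]⟩
  | mul_X p j hp =>
    obtain ⟨p', hp⟩ := hp
    suffices ∃ q : (coordinateRing X)[T;T⁻¹], ∀ (t : Kˣ) (x : X),
        Sum.elim (torusCoord (Pi.mulSingle i t)) x.1 j =
        LaurentPolynomial.eval₂ (evalAt x : coordinateRing X →+* K) t q by
      obtain ⟨q', hq⟩ := this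
      exact ⟨p' * q', fun t x => by rw [map_mul, map_mul, hp, eval_X, hq]⟩
    rcases j with (j | j) | j
    · by_cases h : j = i
      · subst h
        exact ⟨T 1, fun t x => by simp [torusCoord]⟩
      · exact ⟨1, fun t x => by simp [torusCoord, h]⟩
    · by_cases h : j = i
      · subst h
        exact ⟨T (-1), fun t x => by simp [torusCoord]⟩
      · exact ⟨1, fun t x => by simp [torusCoord, h]⟩
    · exact ⟨LaurentPolynomial.C (coordinate X j), fun t x => by
        simp [evalAt_apply, coordinate_apply]⟩

open LaurentPolynomial in
theorem exists_eval₂_eq_sum (q : (coordinateRing X)[T;T⁻¹]) :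
    ∃ (s : Finset ℤ) (g : ℤ → coordinateRing X), ∀ (t : Kˣ) (x : X),
      LaurentPolynomial.eval₂ (evalAt x : coordinateRing X →+* K) t q =
        ∑ m ∈ s, ((t ^ m : Kˣ) : K) * (g m).1 x := by
  suffices ∃ g : ℤ →₀ coordinateRing X, ∀ (t : Kˣ) (x : X),
      LaurentPolynomial.eval₂ (evalAt x : coordinateRing X →+* K) t q =
        g.sum fun m a => ((t ^ m : Kˣ) : K) * a.1 x by
    obtain ⟨g, hg⟩ := this
    exact ⟨g.support, g, hg⟩
  induction q using LaurentPolynomial.induction_on' with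
  | add p q hp hq =>
    obtain ⟨g, hg⟩ := hp
    obtain ⟨h, hh⟩ := hq
    refine ⟨g + h, fun t x => ?_⟩
    rw [map_add, hg, hh, Finsupp.sum_add_index']
    · exact fun m => mul_zero _
    · exact fun m a b => mul_add _ _ _
  | C_mul_T n a =>
    refine ⟨Finsupp.single n a, fun t x => ?_⟩
    rw [LaurentPolynomial.eval₂_C_mul_T, Finsupp.sum_single_index]
    · exact mul_comm _ _
    · exact mul_zero _

variable {φ : (Fin r → Kˣ) →* AutGroup X}

theorem IsRegularAction.exists_laurent_expansion (hφ : IsRegularAction torusCoord φ) (i : Fin r)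
    (f : coordinateRing X) : ∃ (s : Finset ℤ) (g : ℤ → coordinateRing X), ∀ (t : Kˣ) (x : X),
      f.1 ((φ (Pi.mulSingle i t)).1 x) = ∑ m ∈ s, ((t ^ m : Kˣ) : K) * (g m).1 x := by
  obtain ⟨p, hp⟩ := exists_polynomial f
  choose P hP using hφ
  obtain ⟨q, hq⟩ := exists_laurentPolynomial (X := X) (bind₁ P p) i
  obtain ⟨s, g, hg⟩ := exists_eval₂_eq_sum q
  refine ⟨s, g, fun t x => ?_⟩
  rw [← hg, ← hq, hp]
  have h : ((φ (Pi.mulSingle i t)).1 x).1 =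
      fun j => eval (Sum.elim (torusCoord (Pi.mulSingle i t)) x.1) (P j) :=
    funext fun j => hP j (Pi.mulSingle i t, x)
  rw [h]
  exact (eval_bind₁ _ P p).symm

/-- The weight spaces of the `i`-th factor of a torus. -/
noncomputable def factorWeightSpace (φ : (Fin r → Kˣ) →* AutGroup X) (i : Fin r) (m : ℤ) :
    Submodule K (coordinateRing X) :=
  ⨅ t : Kˣ, Module.End.eigenspace (pullback (φ (Pi.mulSingle i t))).toLinearMap
    ((t ^ m : Kˣ) : K)

theorem mem_factorWeightSpace {i : Fin r} {m : ℤ} {f : coordinateRing X} :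
    f ∈ factorWeightSpace φ i m ↔
      ∀ t : Kˣ, pullback (φ (Pi.mulSingle i t)) f = ((t ^ m : Kˣ) : K) • f := by
  simp [factorWeightSpace]

instance (i : Fin r) : SetLike.GradedMonoid (factorWeightSpace φ i) where
  one_mem := mem_factorWeightSpace.2 fun t => by simp
  mul_mem {m n f g} hf hg := by
    rw [mem_factorWeightSpace] at *
    intro t
    rw [map_mul, hf, hg, smul_mul_smul_comm, zpow_add, Units.val_mul]

theorem iSupIndep_factorWeightSpace [CharZero K] (i : Fin r) :
    iSupIndep (factorWeightSpace φ i) := by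
  have h := (Module.End.eigenspaces_iSupIndep (pullback (φ (Pi.mulSingle i
    (Units.mk0 (2 : K) two_ne_zero)))).toLinearMap).comp two_zpow_injective
  refine h.mono fun m => ?_
  refine (iInf_le _ (Units.mk0 (2 : K) two_ne_zero)).trans (le_of_eq ?_)
  simp

theorem IsRegularAction.iSup_factorWeightSpace_eq_top [CharZero K]
    (hφ : IsRegularAction torusCoord φ) (i : Fin r) : ⨆ m, factorWeightSpace φ i m = ⊤ := by
  rw [eq_top_iff]
  intro f _
  obtain ⟨s, g, hg⟩ := hφ.exists_laurent_expansion i f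
  have hf : f = ∑ m ∈ s, g m := by
    refine Subtype.ext (funext fun x => ?_)
    have := hg 1 x
    rw [Pi.mulSingle_one, map_one] at this
    simpa using this
  rw [hf]
  refine Submodule.sum_mem _ fun m hm => Submodule.mem_iSup_of_mem m ?_
  rw [mem_factorWeightSpace]
  intro u
  refine Subtype.ext (funext fun x => ?_)
  rw [pullback_apply, ← sub_eq_zero]
  -- Expand the value of `f` at the translate of `x` by `t * u` in two ways and compare coefficients
  -- of `t ^ m`: each `g m` is a weight vector.
  refine eq_zero_of_forall_sum_zpow_eq_zero s
    (fun m => (g m).1 ((φ (Pi.mulSingle i u)).1 x) - ((u ^ m : Kˣ) : K) * (g m).1 x)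
    (fun t => ?_) m hm
  simp only [mul_sub, Finset.sum_sub_distrib]
  rw [← hg, sub_eq_zero]
  have h : (φ (Pi.mulSingle i t)).1 ((φ (Pi.mulSingle i u)).1 x) =
      (φ (Pi.mulSingle i (t * u))).1 x := by
    rw [Pi.mulSingle_mul, map_mul]
    rfl
  rw [h, hg]
  refine Finset.sum_congr rfl fun m _ => ?_
  rw [mul_zpow, Units.val_mul, mul_assoc]

/-- The infinitesimal generators of a torus action. -/
theorem IsRegularAction.exists_derivation [CharZero K] (hφ : IsRegularAction torusCoord φ)
    (i : Fin r) : ∃ D : Derivation K (coordinateRing X) (coordinateRing X),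
      D.IsIntegralSemisimple ∧ ∀ m, ∀ f ∈ D.weightSpace m, ∀ t : Kˣ,
        pullback (φ (Pi.mulSingle i t)) f = ((t ^ m : Kˣ) : K) • f := by
  classical
  let : GradedAlgebra (factorWeightSpace φ i) :=
    GradedAlgebra.ofIndep _ (iSupIndep_factorWeightSpace i) (hφ.iSup_factorWeightSpace_eq_top i)
  obtain ⟨D, hD⟩ := GradedAlgebra.exists_derivation (factorWeightSpace φ i)
    (fun m => (m : K) • (factorWeightSpace φ i m).subtype) (fun m n f g => by
      simp only [LinearMap.smul_apply, Submodule.subtype_apply, mul_smul_comm]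
      rw [mul_comm g.1, ← add_smul, Int.cast_add, add_comm])
  have hle : ∀ m, factorWeightSpace φ i m ≤ D.weightSpace m := fun m f hf =>
    Derivation.mem_weightSpace.2 (hD m ⟨f, hf⟩)
  have htop : ⨆ m, D.weightSpace m = ⊤ := by
    rw [eq_top_iff, ← hφ.iSup_factorWeightSpace_eq_top i]
    exact iSup_mono hle
  refine ⟨D, htop, fun m f hf => mem_factorWeightSpace.1 ?_⟩
  have hstable : ∀ f ∈ D.weightSpace m, D f ∈ D.weightSpace m := fun f hf => by
    rw [Derivation.mem_weightSpace.1 hf]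
    exact Submodule.smul_mem _ _ hf
  rw [← DirectSum.sum_support_decompose (factorWeightSpace φ i) f] at hf ⊢
  -- Each component of `f` then has both `D`-weight `m` and `D`-weight `j`, so it vanishes unless `j
  -- = m`.
  have hmem := Derivation.mem_of_sum_mem hstable _ _
    (fun j _ => hle j (GradedAlgebra.proj_mem (factorWeightSpace φ i) j f)) hf
  refine Submodule.sum_mem _ fun j hj => ?_
  by_cases hjm : j = m
  · exact hjm ▸ GradedAlgebra.proj_mem (factorWeightSpace φ i) j f
  · have h₀ := Submodule.disjoint_def.1 (Derivation.iSupIndep_weightSpace.pairwiseDisjoint hjm) _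
      (hle j (GradedAlgebra.proj_mem (factorWeightSpace φ i) j f)) (hmem j hj)
    have h₁ : (DirectSum.decompose (factorWeightSpace φ i) f j : coordinateRing X) = 0 := h₀
    rw [h₁]
    exact Submodule.zero_mem _

end ClassicalVariety

/-! ### From lattice gradings to torus actions -/

section TorusCharacters

variable {K A : Type*} [Field K] [CommRing A] [Algebra K A] {r : ℕ}

/-- The value at `t` of the character with exponent vector `m`. -/
def torusCharacter (t : Fin r → Kˣ) : Multiplicative (Fin r → ℤ) →* Kˣ where
  toFun m := ∏ i, t i ^ m.toAdd i
  map_one' := by simp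
  map_mul' m n := by simp [zpow_add, Finset.prod_mul_distrib]

theorem torusCharacter_apply (t : Fin r → Kˣ) (m : Fin r → ℤ) :
    torusCharacter t (Multiplicative.ofAdd m) = ∏ i, t i ^ m i :=
  rfl

theorem GradedAlgebra.algHom_ext {ι : Type*} [AddMonoid ι] [DecidableEq ι]
    (𝒜 : ι → Submodule K A) [GradedAlgebra 𝒜] {S T : A →ₐ[K] A}
    (h : ∀ m, ∀ f ∈ 𝒜 m, S f = T f) : S = T := by
  refine AlgHom.ext fun f => ?_
  induction f using DirectSum.Decomposition.inductionOn 𝒜 with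
  | zero => simp
  | @homogeneous m f => exact h m f f.2
  | add f g hf hg => rw [map_add, map_add, hf, hg]

/-- The action of a torus on an algebra that is graded by the character lattice. -/
theorem GradedAlgebra.exists_torus_action (𝒜 : (Fin r → ℤ) → Submodule K A) [GradedAlgebra 𝒜] :
    ∃ ψ : (Fin r → Kˣ) →* (A →ₐ[K] A), ∀ t m, ∀ f ∈ 𝒜 m,
      ψ t f = ((∏ i, t i ^ m i : Kˣ) : K) • f := by
  choose ψ hψ using fun t : Fin r → Kˣ => GradedAlgebra.exists_algHom_of_character 𝒜
    ((Units.coeHom K).comp (torusCharacter t))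
  have hψ' : ∀ t m, ∀ f ∈ 𝒜 m, ψ t f = ((∏ i, t i ^ m i : Kˣ) : K) • f := hψ
  refine ⟨⟨⟨ψ, ?_⟩, ?_⟩, hψ'⟩
  · refine GradedAlgebra.algHom_ext 𝒜 fun m f hf => ?_
    simp [hψ' _ _ _ hf]
  · intro s t
    refine GradedAlgebra.algHom_ext 𝒜 fun m f hf => ?_
    simp only [AlgHom.mul_apply, hψ' _ _ _ hf, map_smul, smul_smul]
    simp [mul_zpow, Finset.prod_mul_distrib, mul_comm]

end TorusCharacters

/-! ### The greatest subtorus -/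

namespace ClassicalVariety

open MvPolynomial

variable {K : Type*} [Field K] {σ : Type*} {X : Set (σ → K)} {r : ℕ}

theorem exists_polynomial_torusCharacter (m : Fin r → ℤ) :
    ∃ p : MvPolynomial (Fin r ⊕ Fin r) K, ∀ t : Fin r → Kˣ,
      ((∏ i, t i ^ m i : Kˣ) : K) = eval (torusCoord t) p := by
  refine ⟨∏ i, (MvPolynomial.X (Sum.inl i) ^ (m i).toNat *
    MvPolynomial.X (Sum.inr i) ^ (-m i).toNat), fun t => ?_⟩
  simp only [map_prod, map_mul, map_pow, eval_X, Units.coe_prod]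
  refine Finset.prod_congr rfl fun i _ => ?_
  simp only [torusCoord, Sum.elim_inl, Sum.elim_inr]
  rw [← Units.val_pow_eq_pow_val, ← Units.val_pow_eq_pow_val, ← Units.val_mul]
  congr 1
  conv_lhs => rw [← Int.toNat_sub_toNat_neg (m i)]
  rw [zpow_sub, zpow_natCast, zpow_natCast, inv_pow]

theorem isRegularAction_actionOfAlgHom (hX : IsZariskiClosed X)
    (𝒜 : (Fin r → ℤ) → Submodule K (coordinateRing X)) [GradedAlgebra 𝒜]
    {ψ : (Fin r → Kˣ) →* (coordinateRing X →ₐ[K] coordinateRing X)}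
    (hψ : ∀ t m, ∀ f ∈ 𝒜 m, ψ t f = ((∏ i, t i ^ m i : Kˣ) : K) • f) :
    IsRegularAction torusCoord (actionOfAlgHom hX ψ) := by
  intro j
  have key : ∀ f : coordinateRing X, ∃ P : MvPolynomial ((Fin r ⊕ Fin r) ⊕ σ) K,
      ∀ t x, (ψ t f).1 x = eval (Sum.elim (torusCoord t) x.1) P := by
    intro f
    induction f using DirectSum.Decomposition.inductionOn 𝒜 with
    | zero => exact ⟨0, fun t x => by rw [map_zero, map_zero]; rfl⟩
    | @homogeneous m f =>
      obtain ⟨p, hp⟩ := exists_polynomial_torusCharacter (K := K) m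
      obtain ⟨q, hq⟩ := exists_polynomial f.1
      refine ⟨rename Sum.inl p * rename Sum.inr q, fun t x => ?_⟩
      rw [hψ t m f f.2, map_mul, eval_rename, eval_rename]
      change ((∏ i, t i ^ m i : Kˣ) : K) * f.1.1 x = _
      rw [hp, hq]
      rfl
    | add f g hf hg =>
      obtain ⟨p, hp⟩ := hf
      obtain ⟨q, hq⟩ := hg
      refine ⟨p + q, fun t x => ?_⟩
      rw [map_add, map_add, ← hp, ← hq]
      rfl
  obtain ⟨P, hP⟩ := key (coordinate X j)
  exact ⟨P, fun ⟨t, x⟩ => hP t x⟩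

/-- A torus that acts with generating weights acts faithfully. -/
theorem injective_of_span_weights_eq_top {A : Type*} [CommRing A] [Algebra K A]
    (𝒜 : (Fin r → ℤ) → Submodule K A) (hspan : Submodule.span ℤ {m | 𝒜 m ≠ ⊥} = ⊤)
    {ψ : (Fin r → Kˣ) →* (A →ₐ[K] A)}
    (hψ : ∀ t m, ∀ f ∈ 𝒜 m, ψ t f = ((∏ i, t i ^ m i : Kˣ) : K) • f)
    {t : Fin r → Kˣ} (ht : ψ t = 1) : t = 1 := by
  have key : ∀ m : Fin r → ℤ, torusCharacter t (Multiplicative.ofAdd m) = 1 := by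
    intro m
    have hm : m ∈ Submodule.span ℤ {m | 𝒜 m ≠ ⊥} := hspan ▸ Submodule.mem_top
    induction hm using Submodule.span_induction with
    | mem m hm =>
      obtain ⟨f, hf, hne⟩ := Submodule.exists_mem_ne_zero_of_ne_bot hm
      have h := hψ t m f hf
      rw [ht, AlgHom.one_apply] at h
      have h' : (1 - ((∏ i, t i ^ m i : Kˣ) : K)) • f = 0 := by
        rw [sub_smul, one_smul, ← h, sub_self]
      have := (smul_eq_zero.1 h').resolve_right hne
      exact Units.ext (sub_eq_zero.1 this).symm
    | zero => exact map_one _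
    | add m n _ _ hm hn => rw [ofAdd_add, map_mul, hm, hn, one_mul]
    | smul a m _ hm => rw [ofAdd_zsmul, map_zpow, hm, one_zpow]
  funext i
  have := key (Pi.single i 1)
  rw [torusCharacter_apply, Finset.prod_eq_single i] at this
  · simpa using this
  · intro j _ hj
    simp [hj]
  · simp

theorem isSubtorus_range {φ : (Fin r → Kˣ) →* AutGroup X} (hφ : IsRegularAction torusCoord φ)
    (hinj : Function.Injective φ) : IsSubtorus φ.range :=
  ⟨r, MonoidHom.ofInjective hinj, hφ⟩

theorem IsSubtorus.map_conj {T : Subgroup (AutGroup X)} (hT : IsSubtorus T) (g : AutGroup X) :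
    IsSubtorus (T.map (MulAut.conj g).toMonoidHom) := by
  obtain ⟨r, φ, hφ⟩ := hT
  refine ⟨r, φ.trans (T.equivMapOfInjective _ (MulAut.conj g).injective), fun j => ?_⟩
  obtain ⟨q, hq⟩ := g.2.1 j
  choose P hP using hφ
  choose R hR using g.2.2
  let Q : (Fin r ⊕ Fin r) ⊕ σ → MvPolynomial ((Fin r ⊕ Fin r) ⊕ σ) K :=
    Sum.elim (fun i => MvPolynomial.X (Sum.inl i)) (fun l => rename Sum.inr (R l))
  -- The polynomials of `g⁻¹`, of the action and of `g` are composed in this order.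
  refine ⟨bind₁ (fun k => bind₁ Q (P k)) q, fun ⟨t, x⟩ => ?_⟩
  have h₁ : (fun a => eval (Sum.elim (torusCoord t) x.1) (Q a)) =
      Sum.elim (torusCoord t) (g.1⁻¹ x).1 := by
    funext a
    rcases a with i | l
    · simp [Q]
    · simp only [Q, Sum.elim_inr, eval_rename]
      exact (hR l x).symm
  have h₂ : (fun k => eval (Sum.elim (torusCoord t) x.1) (bind₁ Q (P k))) =
      ((φ t).1.1 (g.1⁻¹ x)).1 := by
    funext k
    rw [eval_bind₁, h₁]
    exact (hP k (t, g.1⁻¹ x)).symm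
  rw [eval_bind₁]
  refine Eq.trans ?_ (congrArg (fun y => eval y q) h₂.symm)
  exact hq ((φ t).1.1 (g.1⁻¹ x))

/-- Subtori of the automorphism group of a rigid irreducible affine variety are contained in a
common subtorus. -/
theorem IsRigid.exists_greatest_isSubtorus [CharZero K] [Finite σ] (hrigid : IsRigid X)
    (hX : IsIrreducibleAffineVariety X) :
    ∃ T : Subgroup (AutGroup X), IsSubtorus T ∧ ∀ S, IsSubtorus S → S ≤ T := by
  have := hX.isDomain
  have hlnd := hrigid.derivation_eq_zero hX.isClosed
  obtain ⟨r, 𝒜, ⟨_⟩, hwt, hspan⟩ := Derivation.exists_lattice_grading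
    (S := {D : Derivation K (coordinateRing X) (coordinateRing X) | D.IsIntegralSemisimple})
    (fun D hD => hD) (fun D hD E hE => hD.apply_comm hlnd hE)
  obtain ⟨ψ, hψ⟩ := GradedAlgebra.exists_torus_action 𝒜
  have hpull := pullback_actionOfAlgHom hX.isClosed ψ
  refine ⟨(actionOfAlgHom hX.isClosed ψ).range,
    isSubtorus_range (isRegularAction_actionOfAlgHom hX.isClosed 𝒜 hψ)
      ((injective_iff_map_eq_one _).2 fun t ht =>
        injective_of_span_weights_eq_top 𝒜 hspan hψ ?_), ?_⟩
  · rw [← hpull, ht]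
    rfl
  · rintro S ⟨s, φ, hφ⟩ g hg
    have hfactor : ∀ (i : Fin s) (u : Kˣ),
        (φ (Pi.mulSingle i u)).1 ∈ (actionOfAlgHom hX.isClosed ψ).range := by
      intro i u
      obtain ⟨D, hD, hDφ⟩ := hφ.exists_derivation i
      obtain ⟨b, hb⟩ := hwt D hD
      -- The generator has eigenvalue `∑ b j * m j` in degree `m`, so the factor is the
      -- one-parameter subgroup with exponent vector `b`.
      refine ⟨fun j => u ^ b j, pullback_injective ?_⟩
      rw [hpull]
      refine GradedAlgebra.algHom_ext 𝒜 fun m f hf => ?_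
      rw [hψ _ m f hf]
      refine Eq.trans ?_ (hDφ _ f (Derivation.mem_weightSpace.2 (hb m f hf)) u).symm
      simp_rw [← zpow_mul]
      congr 2
      exact (map_sum (zpowersHom Kˣ u).toAdditive _ _).symm
    obtain ⟨t, ht⟩ := φ.surjective ⟨g, hg⟩
    have hmem : t ∈ (actionOfAlgHom hX.isClosed ψ).range.comap
        (S.subtype.comp φ.toMonoidHom) := by
      rw [← Finset.univ_prod_mulSingle t]
      exact Subgroup.prod_mem _ fun i _ => hfactor i (t i)
    have hg' : (φ t).1 = g := congrArg Subtype.val ht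
    exact hg' ▸ hmem

end ClassicalVariety

theorem theorem1 {K : Type*} [Field K] [IsAlgClosed K] [CharZero K] {n : ℕ}
    (X : Set (Fin n → K)) (hX : ClassicalVariety.IsIrreducibleAffineVariety X)
    (hrigid : ClassicalVariety.IsRigid X) :
    ∃ T : Subgroup (ClassicalVariety.AutGroup X),
      ClassicalVariety.IsSubtorus T ∧
      (∀ S : Subgroup (ClassicalVariety.AutGroup X), ClassicalVariety.IsSubtorus S → S ≤ T) ∧
      (∀ S : Subgroup (ClassicalVariety.AutGroup X),
        Maximal ClassicalVariety.IsSubtorus S ↔ S = T) ∧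
      T.Normal := by
  obtain ⟨T, hT, hle⟩ := hrigid.exists_greatest_isSubtorus hX
  refine ⟨T, hT, hle, fun S => ⟨fun hS => ?_, ?_⟩, ⟨fun t ht g => ?_⟩⟩
  · exact (hS.eq_of_le hT (hle S hS.prop))
  · rintro rfl
    exact ⟨hT, fun S hS _ => hle S hS⟩
  · exact hle _ (hT.map_conj g) ⟨t, ht, rfl⟩
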